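/- A \emph{coframe} is a complete lattice $L$ in which $a \vee \bigwedge_{i \in I} b_i = \bigwedge_{i \in I} (a \vee b_i)$ for every $a \in L$ and every family $(b_i)_{i \in I}$ in $L$; a morphism of coframes is a map that preserves all infima and all finite suprema. A \emph{filter} on $L$ is a non-empty upwards-closed subset of $L$ closed under binary meets ($L$ itself is allowed), and $\mathbb{F}L$ is the set of filters on $L$ ordered by inclusion. Let $\mathbf{Cv\,coFrm}$ be the category whose objects are the convergence coframes, namely the pairs $(L, \lim_L)$ of a coframe $L$ and a monotonic map $\lim_L \colon \mathbb{F}L \to L$, and whose morphisms $\varphi \colon (L, \lim_L) \to (L', \lim_{L'})$ are the coframe morphisms $\varphi \colon L \to L'$ that are continuous, i.e. satisfy $\lim_{L'} \mathcal{F} \leq \varphi(\lim_L \varphi^{-1}(\mathcal{F}))$ for every $\mathcal{F} \in \mathbb{F}L'$. Let $\mathbf{Cv_{cl}\,coFrm}$ be its full subcategory of classical convergence coframes, namely those in which $\lim_L \mathcal{F} = \lim_L \mathcal{G}$ for any two filters $\mathcal{F}, \mathcal{G}$ on $L$ that contain the same complemented elements of $L$. Then the categories $\mathbf{Cv\,coFrm}$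 and $\mathbf{Cv_{cl}\,coFrm}$ are both complete and cocomplete: they have all small limits and all small colimits. -/

import Mathlib

open CategoryTheory CategoryTheory.Limits Order

universe u

/-- A morphism of coframes: a map that preserves all infima and all finite suprema. -/
structure CoframeHom (α β : Type*) [CompleteLattice α] [CompleteLattice β] extends
    SupBotHom α β where
  /-- A coframe morphism preserves arbitrary infima. -/
  map_sInf' (s : Set α) : toFun (sInf s) = sInf (toFun '' s)

namespace CoframeHom

instance {α β : Type*} [CompleteLattice α] [CompleteLattice β] :
    FunLike (CoframeHom α β) α β where
  coe f := f.toFun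
  coe_injective f g h := by
    obtain ⟨⟨⟨_, _⟩, _⟩, _⟩ := f
    obtain ⟨⟨⟨_, _⟩, _⟩, _⟩ := g
    congr

instance {α β : Type*} [CompleteLattice α] [CompleteLattice β] :
    SupBotHomClass (CoframeHom α β) α β where
  map_sup f := f.map_sup'
  map_bot f := f.map_bot'

instance {α β : Type*} [CompleteLattice α] [CompleteLattice β] :
    sInfHomClass (CoframeHom α β) α β where
  map_sInf f := f.map_sInf'

@[ext]
theorem ext {α β : Type*} [CompleteLattice α] [CompleteLattice β] {f g : CoframeHom α β}
    (h : ∀ a, f a = g a) : f = g :=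
  DFunLike.ext f g h

/-- The identity morphism of a coframe. -/
def id (α : Type*) [CompleteLattice α] : CoframeHom α α where
  toFun a := a
  map_sup' _ _ := rfl
  map_bot' := rfl
  map_sInf' s := by simp

/-- Composition of coframe morphisms. -/
def comp {α β γ : Type*} [CompleteLattice α] [CompleteLattice β] [CompleteLattice γ]
    (g : CoframeHom β γ) (f : CoframeHom α β) : CoframeHom α γ where
  toFun a := g (f a)
  map_sup' a b := by simp
  map_bot' := by simp
  map_sInf' s := by rw [map_sInf, map_sInf, Set.image_image]

@[simp]
theorem id_apply {α : Type*} [CompleteLattice α] (a : α) : CoframeHom.id α a = a := rfl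

@[simp]
theorem comp_apply {α β γ : Type*} [CompleteLattice α] [CompleteLattice β] [CompleteLattice γ]
    (g : CoframeHom β γ) (f : CoframeHom α β) (a : α) : g.comp f a = g (f a) := rfl

/-- The inverse image `φ⁻¹(F)` of a filter `F` under a coframe morphism `φ`. -/
def preimage {α β : Type*} [CompleteLattice α] [CompleteLattice β] (φ : CoframeHom α β)
    (F : PFilter β) : PFilter α :=
  IsPFilter.toPFilter (F := φ ⁻¹' (F : Set β)) <| IsPFilter.of_def
    ⟨⊤, by
      change φ ⊤ ∈ F
      rw [map_top]
      exact PFilter.top_mem⟩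
    (fun x hx y hy => ⟨x ⊓ y, by
      change φ (x ⊓ y) ∈ F
      rw [map_inf]
      exact PFilter.inf_mem hx hy, inf_le_left, inf_le_right⟩)
    (fun hxy hx => PFilter.mem_of_le (OrderHomClass.mono φ hxy) hx)

@[simp]
theorem mem_preimage {α β : Type*} [CompleteLattice α] [CompleteLattice β]
    {φ : CoframeHom α β} {F : PFilter β} {a : α} : a ∈ φ.preimage F ↔ φ a ∈ F :=
  Iff.rfl

end CoframeHom

/-- The category of coframes. -/
structure CoFrm where
  /-- Construct a bundled coframe from the underlying type and type class. -/
  of ::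
  /-- The underlying coframe. -/
  (carrier : Type u)
  [str : Coframe carrier]

attribute [instance] CoFrm.str

namespace CoFrm

instance : CoeSort CoFrm.{u} (Type u) :=
  ⟨CoFrm.carrier⟩

/-- Morphisms in the category of coframes. -/
@[ext]
structure Hom (L M : CoFrm.{u}) where
  /-- The underlying coframe morphism. -/
  hom : CoframeHom L M

instance : Category CoFrm.{u} where
  Hom L M := Hom L M
  id L := ⟨CoframeHom.id L⟩
  comp f g := ⟨g.hom.comp f.hom⟩

end CoFrm

/-- A convergence coframe: a coframe `L` with a monotonic map `lim : 𝔽 L → L`, where `𝔽 L` is the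
set of all filters on `L` (including the improper filter `L`) ordered by inclusion. -/
structure CvCoFrm where
  /-- The underlying coframe. -/
  toCoFrm : CoFrm.{u}
  /-- The convergence structure. -/
  lim : PFilter toCoFrm →o toCoFrm

namespace CvCoFrm

/-- A coframe morphism `φ` between convergence coframes `L` and `M` is continuous if
`lim F ≤ φ (lim (φ⁻¹ F))` for every filter `F` on `M`. -/
def IsContinuous (L M : CvCoFrm.{u}) (φ : CoframeHom L.toCoFrm M.toCoFrm) : Prop :=
  ∀ F : PFilter M.toCoFrm, M.lim F ≤ φ (L.lim (φ.preimage F))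

/-- Morphisms of convergence coframes: the continuous coframe morphisms. -/
@[ext]
structure Hom (L M : CvCoFrm.{u}) where
  /-- The underlying morphism in the category of coframes. -/
  toHom : L.toCoFrm ⟶ M.toCoFrm
  continuous : IsContinuous L M toHom.hom

/-- The category of convergence coframes. -/
instance : Category CvCoFrm.{u} where
  Hom L M := Hom L M
  id L := ⟨𝟙 L.toCoFrm, fun _ => le_rfl⟩
  comp f g := ⟨f.toHom ≫ g.toHom, fun F =>
    (g.continuous F).trans
      (OrderHomClass.mono g.toHom.hom (f.continuous (g.toHom.hom.preimage F)))⟩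

/-- A convergence coframe is classical if any two filters that contain the same complemented
elements have the same limit. -/
def IsClassical : ObjectProperty CvCoFrm.{u} := fun L =>
  ∀ F G : PFilter L.toCoFrm,
    (F : Set L.toCoFrm) ∩ {a | IsComplemented a} = (G : Set L.toCoFrm) ∩ {a | IsComplemented a} →
      L.lim F = L.lim G

end CvCoFrm

/-- The full subcategory of classical convergence coframes. -/
abbrev CvclCoFrm := CvCoFrm.IsClassical.{u}.FullSubcategory

/-!
The forgetful functor from convergence coframes to coframes is topological: a (co)limit of
convergence coframes is a (co)limit of the underlying coframes, equipped with the initial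
(`CvCoFrm.initialLim`) or the final (`CvCoFrm.finalLim`) convergence structure with respect to its
legs. So the (co)completeness of `CvCoFrm` reduces to that of `CoFrm`.

Limits of coframes are computed on underlying sets. For colimits, distributivity says that the
subcoframe generated by a family `x : σ → M` consists of the elements `⨅ A ∈ U, ⨆ s ∈ A, x s` with
`U` a set of finite subsets of `σ` (`CoFrm.normalForm`). It is therefore a quotient of
`Set (Finset σ)`, whatever `M` is. Applied to the elements of all the objects of a diagram, this
gives a small set of cocones through which every cocone factors, and the general adjoint functor
theorem, applied to the constant diagram functor, provides the colimit.

The classical convergence coframes are coreflective in all of them: the coreflection of `L` has the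
same underlying coframe, and `G` now converges to the join of the limits of all the filters whose
complemented elements lie in `G` (`CvCoFrm.classicalLim`). A coreflective subcategory of a complete
and cocomplete category is complete and cocomplete.
-/

/-! ### Coframes induced along injections -/

/-- An injection into a coframe whose range is closed under all infima and finite suprema makes its
domain a coframe, so that the injection is a coframe morphism. -/
theorem CoframeHom.exists_of_injective {α M : Type*} [Coframe M] (f : α → M)
    (hf : Function.Injective f) (h_sInf : ∀ s ⊆ Set.range f, sInf s ∈ Set.range f)
    (h_sup : ∀ a b, f a ⊔ f b ∈ Set.range f) (h_bot : ⊥ ∈ Set.range f) :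
    ∃ (_ : Coframe α) (φ : CoframeHom α M), ⇑φ = f := by
  choose g hg using fun s : Set α => h_sInf (f '' s) (Set.image_subset_range f s)
  let _ : PartialOrder α := PartialOrder.lift f hf
  let _ : InfSet α := ⟨g⟩
  let _ : CompleteLattice α := completeLatticeOfInf α fun s => by
    refine ⟨fun a ha => ?_, fun a ha => ?_⟩
    · change f (g s) ≤ f a
      rw [hg]
      exact sInf_le (Set.mem_image_of_mem f ha)
    · change f a ≤ f (g s)
      rw [hg]
      refine le_sInf ?_
      rintro _ ⟨b, hb, rfl⟩
      exact ha hb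
  have map_sInf (s : Set α) : f (sInf s) = sInf (f '' s) := hg s
  have map_sup (a b : α) : f (a ⊔ b) = f a ⊔ f b := by
    obtain ⟨c, hc⟩ := h_sup a b
    refine le_antisymm ?_ (sup_le (le_sup_left : a ≤ a ⊔ b) (le_sup_right : b ≤ a ⊔ b))
    rw [← hc]
    exact (sup_le (hc ▸ le_sup_left : f a ≤ f c) (hc ▸ le_sup_right : f b ≤ f c) : a ⊔ b ≤ c)
  have map_bot : f ⊥ = ⊥ := by
    obtain ⟨c, hc⟩ := h_bot
    exact le_bot_iff.1 (hc ▸ (bot_le : ⊥ ≤ c))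
  refine ⟨Coframe.ofMinimalAxioms ⟨fun a s => ?_⟩, ⟨⟨⟨f, map_sup⟩, map_bot⟩, map_sInf⟩, rfl⟩
  change f _ ≤ f _
  rw [map_sup, map_sInf, sup_sInf_eq]
  simp only [le_iInf_iff, Set.forall_mem_image]
  intro b hb
  rw [← map_sup]
  exact (iInf₂_le b hb : ⨅ b ∈ s, a ⊔ b ≤ a ⊔ b)

namespace CoFrm

@[simp]
theorem comp_hom_apply {L M N : CoFrm.{u}} (f : L ⟶ M) (g : M ⟶ N) (a : L) :
    (f ≫ g).hom a = g.hom (f.hom a) := rfl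

theorem hom_ext {L M : CoFrm.{u}} {f g : L ⟶ M} (h : ∀ a, f.hom a = g.hom a) : f = g :=
  Hom.ext (CoframeHom.ext h)

/-- A function into the domain of an injective coframe morphism is a coframe morphism if its
composite with the injection is one. -/
theorem exists_lift_of_injective {L M N : CoFrm.{u}} (φ : M ⟶ N) (hφ : Function.Injective φ.hom)
    (ψ : L ⟶ N) (g : L → M) (hg : ∀ a, φ.hom (g a) = ψ.hom a) :
    ∃ χ : L ⟶ M, ⇑χ.hom = g := by
  refine ⟨⟨⟨⟨⟨g, fun a b => hφ ?_⟩, hφ ?_⟩, fun s => hφ ?_⟩⟩, rfl⟩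
  · simp [hg]
  · simp [hg]
  · change φ.hom (g (sInf s)) = φ.hom (sInf (g '' s))
    rw [hg, map_sInf, map_sInf, Set.image_image]
    simp only [hg]

/-! ### Limits of coframes -/

instance hasLimits : HasLimits CoFrm.{u} where
  has_limits_of_shape J _ := ⟨fun F => by
    -- The sections of `F` form a subcoframe of the product of its objects.
    let X : Type u := {x : ∀ j, F.obj j // ∀ ⦃i j⦄ (f : i ⟶ j), (F.map f).hom (x i) = x j}
    have range_val : Set.range (Subtype.val : X → ∀ j, F.obj j) =
        {x | ∀ ⦃i j⦄ (f : i ⟶ j), (F.map f).hom (x i) = x j} := Subtype.range_val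
    obtain ⟨_, φ, hφ⟩ := CoframeHom.exists_of_injective (Subtype.val : X → ∀ j, F.obj j)
      Subtype.val_injective
      (fun s hs => by
        rw [range_val] at hs ⊢
        intro i j f
        rw [sInf_apply_eq_sInf_image, sInf_apply_eq_sInf_image, map_sInf, Set.image_image]
        exact congrArg sInf (Set.image_congr fun x hx => hs hx f))
      (fun a b => by
        rw [range_val]
        intro i j f
        rw [Pi.sup_apply, Pi.sup_apply, map_sup, a.2 f, b.2 f])
      (by
        rw [range_val]
        intro i j f
        exact map_bot _)
    let p (j : J) : CoframeHom (∀ j, F.obj j) (F.obj j) :=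
      { toFun := fun x => x j
        map_sup' := fun _ _ => rfl
        map_bot' := rfl
        map_sInf' := fun _ => sInf_apply_eq_sInf_image }
    let c : Cone F :=
      { pt := of X
        π :=
          { app := fun j => ⟨(p j).comp φ⟩
            naturality := fun i j f => hom_ext fun x => by
              change φ x j = (F.map f).hom (φ x i)
              rw [hφ]
              exact (x.2 f).symm } }
    have hc (j : J) (x : X) : (c.π.app j).hom x = x.1 j := congrFun (congrFun hφ x) j
    have exists_lift (s : Cone F) : ∃ χ : s.pt ⟶ c.pt, ∀ a j, (χ.hom a).1 j = (s.π.app j).hom a := by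
      let q (j : J) : CoframeHom s.pt (F.obj j) := (s.π.app j).hom
      have hq {i j : J} (f : i ⟶ j) (a : s.pt) : (F.map f).hom (q i a) = q j a :=
        congrArg (fun k => k.hom a) (s.w f)
      let ψ : s.pt ⟶ of (∀ j, F.obj j) :=
        ⟨{  toFun := fun a j => q j a
            map_sup' := fun a b => funext fun j => map_sup _ a b
            map_bot' := funext fun j => map_bot _
            map_sInf' := fun t => funext fun j => by
              rw [sInf_apply_eq_sInf_image, Set.image_image]
              exact map_sInf (q j) t }⟩
      obtain ⟨χ, hχ⟩ := exists_lift_of_injective (L := s.pt) (M := of X) ⟨φ⟩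
        (hφ ▸ Subtype.val_injective) ψ
        (fun a => ⟨fun j => q j a, fun i j f => hq f a⟩)
        (fun a => by
          change φ _ = _
          rw [hφ]
          rfl)
      exact ⟨χ, fun a j => by rw [hχ]⟩
    choose lift hlift using exists_lift
    exact ⟨⟨c,
      { lift := lift
        fac := fun s j => hom_ext fun a => by rw [comp_hom_apply, hc, hlift]
        uniq := fun s m hm => hom_ext fun a => Subtype.ext <| funext fun j => by
          rw [hlift, ← hm j, comp_hom_apply, hc] }⟩⟩⟩

/-! ### Colimits of coframes -/

/-- The infimum, over the finite sets `A ∈ U`, of the joins of the families `(x s)_{s ∈ A}`. By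
distributivity, these are all the elements of the subcoframe generated by the elements `x s`. -/
def normalForm {σ M : Type*} [Coframe M] (x : σ → M) (U : Set (Finset σ)) : M :=
  ⨅ A ∈ U, A.sup x

theorem normalForm_singleton {σ M : Type*} [Coframe M] (x : σ → M) (s : σ) :
    normalForm x {{s}} = x s := by
  simp [normalForm]

theorem sInf_mem_range_normalForm {σ M : Type*} [Coframe M] (x : σ → M) {S : Set M}
    (hS : S ⊆ Set.range (normalForm x)) : sInf S ∈ Set.range (normalForm x) := by
  refine ⟨⋃ U ∈ normalForm x ⁻¹' S, U, ?_⟩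
  simp only [normalForm, iInf_iUnion]
  change ⨅ U ∈ normalForm x ⁻¹' S, normalForm x U = sInf S
  rw [← sInf_image, Set.image_preimage_eq_of_subset hS]

theorem sup_mem_range_normalForm {σ M : Type*} [Coframe M] (x : σ → M) (U V : Set (Finset σ)) :
    normalForm x U ⊔ normalForm x V ∈ Set.range (normalForm x) := by
  classical
  refine ⟨Set.image2 (· ∪ ·) U V, ?_⟩
  simp only [normalForm, iInf_image2, Finset.sup_union, ← iInf₂_sup_eq, ← sup_iInf₂_eq]

theorem bot_mem_range_normalForm {σ M : Type*} [Coframe M] (x : σ → M) :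
    ⊥ ∈ Set.range (normalForm x) :=
  ⟨{∅}, by simp [normalForm]⟩

/-- A cocone under `F` factors through the subcoframe generated by the images of its legs, which is
a quotient of `Set (Finset (Σ j, F.obj j))`. -/
theorem solutionSetCondition_const {J : Type u} [SmallCategory J] :
    SolutionSetCondition.{u} (Functor.const J : CoFrm.{u} ⥤ J ⥤ CoFrm.{u}) := by
  intro F
  let T := Set (Finset (Σ j, F.obj j))
  -- All the coframe structures on all the quotients of `T`, with all the cocones to them.
  refine ⟨Σ (r : Setoid T) (_ : Coframe (Quotient r)), F ⟶ (Functor.const J).obj (of (Quotient r)),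
    fun i => @of (Quotient i.1) i.2.1, fun i => i.2.2, fun M h => ?_⟩
  let x (s : Σ j, F.obj j) : M := (h.app s.1).hom s.2
  let ι : Quotient (Setoid.ker (normalForm x)) → M := Setoid.kerLift (normalForm x)
  have hι : Function.Injective ι := Setoid.kerLift_injective _
  have range_ι : Set.range ι = Set.range (normalForm x) := Set.range_quot_lift _
  obtain ⟨_, φ, hφ⟩ := CoframeHom.exists_of_injective ι hι
    (fun s hs => by
      rw [range_ι] at hs ⊢
      exact sInf_mem_range_normalForm x hs)
    (fun a b => by
      rw [range_ι]
      induction a, b using Quotient.inductionOn₂ with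
      | _ U V => exact sup_mem_range_normalForm x U V)
    (by
      rw [range_ι]
      exact bot_mem_range_normalForm x)
  let Q : CoFrm.{u} := of (Quotient (Setoid.ker (normalForm x)))
  -- `g` identifies `Q` with the subcoframe of `M` generated by the images of the legs of `h`.
  let g : Q ⟶ M := ⟨φ⟩
  have hg : Function.Injective g.hom := by
    change Function.Injective φ
    rwa [hφ]
  have (j : J) : ∃ χ : F.obj j ⟶ Q, ∀ a, g.hom (χ.hom a) = (h.app j).hom a := by
    have key (a : F.obj j) : g.hom (Quotient.mk _ {{⟨j, a⟩}}) = (h.app j).hom a := by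
      change φ _ = _
      rw [hφ]
      exact normalForm_singleton x ⟨j, a⟩
    obtain ⟨χ, hχ⟩ := exists_lift_of_injective g hg (h.app j) _ key
    exact ⟨χ, fun a => by rw [hχ, key]⟩
  choose χ hχ using this
  refine ⟨⟨Setoid.ker (normalForm x), inferInstance, ⟨χ, fun i j f => hom_ext fun a => hg ?_⟩⟩,
    g, ?_⟩
  · change g.hom ((χ j).hom ((F.map f).hom a)) = g.hom ((χ i).hom a)
    rw [hχ, hχ]
    exact congrArg (fun k => k.hom a) (h.naturality f)
  · ext j : 2
    exact hom_ext fun a => hχ j a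

instance hasColimits : HasColimits CoFrm.{u} where
  has_colimits_of_shape _ _ := hasColimitsOfShape_iff_isRightAdjoint_const.2 <|
    isRightAdjoint_of_preservesLimits_of_solutionSetCondition _ solutionSetCondition_const

end CoFrm

/-! ### Initial and final convergence structures -/

namespace CvCoFrm

theorem hom_ext {L M : CvCoFrm.{u}} {f g : L ⟶ M} (h : f.toHom = g.toHom) : f = g :=
  Hom.ext h

/-- The functor forgetting the convergence structure. -/
@[simps]
def forget : CvCoFrm.{u} ⥤ CoFrm.{u} where
  obj L := L.toCoFrm
  map f := f.toHom

/-- The convergence structure on `L` that is initial with respect to the morphisms `π i`: the least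
one making all of them continuous. A filter `G` converges to the least `x` such that
`lim F ≤ π i x` whenever `(π i)⁻¹ F ≤ G`. -/
def initialLim {ι : Type*} {L : CoFrm.{u}} (M : ι → CvCoFrm.{u})
    (π : ∀ i, L ⟶ (M i).toCoFrm) : PFilter L →o L where
  toFun G := sInf {x | ∀ i F, (π i).hom.preimage F ≤ G → (M i).lim F ≤ (π i).hom x}
  monotone' _ _ h := sInf_le_sInf fun _ hx i F hF => hx i F (hF.trans h)

theorem isContinuous_initialLim {ι : Type*} {L : CoFrm.{u}} (M : ι → CvCoFrm.{u})
    (π : ∀ i, L ⟶ (M i).toCoFrm) (i : ι) :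
    IsContinuous ⟨L, initialLim M π⟩ (M i) (π i).hom := by
  intro F
  change _ ≤ (π i).hom (sInf _)
  rw [map_sInf]
  refine le_sInf ?_
  rintro _ ⟨x, hx, rfl⟩
  exact hx i F le_rfl

/-- The universal property of the initial convergence structure. -/
theorem isContinuous_to_initialLim {ι : Type*} {L : CoFrm.{u}} {M : ι → CvCoFrm.{u}}
    {π : ∀ i, L ⟶ (M i).toCoFrm} {N : CvCoFrm.{u}} {ψ : N.toCoFrm ⟶ L}
    (h : ∀ i, IsContinuous N (M i) (ψ ≫ π i).hom) :
    IsContinuous N ⟨L, initialLim M π⟩ ψ.hom := fun _ =>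
  sInf_le fun i F hF => (h i F).trans <| OrderHomClass.mono (π i).hom <|
    OrderHomClass.mono ψ.hom <| N.lim.monotone fun _ ha => hF ha

/-- The convergence structure on `L` that is final with respect to the morphisms `κ i`: the greatest
one making all of them continuous. -/
def finalLim {ι : Type*} {L : CoFrm.{u}} (M : ι → CvCoFrm.{u})
    (κ : ∀ i, (M i).toCoFrm ⟶ L) : PFilter L →o L where
  toFun F := ⨅ i, (κ i).hom ((M i).lim ((κ i).hom.preimage F))
  monotone' _ _ h := iInf_mono fun i => OrderHomClass.mono (κ i).hom <|
    (M i).lim.monotone fun _ ha => h ha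

theorem isContinuous_finalLim {ι : Type*} {L : CoFrm.{u}} (M : ι → CvCoFrm.{u})
    (κ : ∀ i, (M i).toCoFrm ⟶ L) (i : ι) :
    IsContinuous (M i) ⟨L, finalLim M κ⟩ (κ i).hom := fun _ =>
  iInf_le _ i

/-- The universal property of the final convergence structure. -/
theorem isContinuous_from_finalLim {ι : Type*} {L : CoFrm.{u}} {M : ι → CvCoFrm.{u}}
    {κ : ∀ i, (M i).toCoFrm ⟶ L} {N : CvCoFrm.{u}} {ψ : L ⟶ N.toCoFrm}
    (h : ∀ i, IsContinuous (M i) N (κ i ≫ ψ).hom) :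
    IsContinuous ⟨L, finalLim M κ⟩ N ψ.hom := by
  intro F
  change _ ≤ ψ.hom (⨅ i, _)
  rw [map_iInf]
  exact le_iInf fun i => h i F

/-! ### Limits and colimits of convergence coframes -/

instance hasLimits : HasLimits CvCoFrm.{u} where
  has_limits_of_shape J _ := ⟨fun F => by
    let c := limit.cone (F ⋙ forget)
    have hc : IsLimit c := limit.isLimit _
    exact ⟨
      { pt := ⟨c.pt, initialLim F.obj c.π.app⟩
        π :=
          { app := fun j => ⟨c.π.app j, isContinuous_initialLim F.obj c.π.app j⟩
            naturality := fun i j f => hom_ext (c.π.naturality f) } },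
      { lift := fun s => ⟨hc.lift (forget.mapCone s), isContinuous_to_initialLim fun j => by
          have h : hc.lift (forget.mapCone s) ≫ c.π.app j = (s.π.app j).toHom := hc.fac _ j
          exact h ▸ (s.π.app j).continuous⟩
        fac := fun s j => hom_ext (hc.fac (forget.mapCone s) j)
        uniq := fun s m hm => hom_ext <| hc.uniq (forget.mapCone s) m.toHom fun j =>
          congrArg Hom.toHom (hm j) }⟩⟩

instance hasColimits : HasColimits CvCoFrm.{u} where
  has_colimits_of_shape J _ := ⟨fun F => by
    let c := colimit.cocone (F ⋙ forget)
    have hc : IsColimit c := colimit.isColimit _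
    exact ⟨
      { pt := ⟨c.pt, finalLim F.obj c.ι.app⟩
        ι :=
          { app := fun j => ⟨c.ι.app j, isContinuous_finalLim F.obj c.ι.app j⟩
            naturality := fun i j f => hom_ext (c.ι.naturality f) } },
      { desc := fun s => ⟨hc.desc (forget.mapCocone s), isContinuous_from_finalLim fun j => by
          have h : c.ι.app j ≫ hc.desc (forget.mapCocone s) = (s.ι.app j).toHom := hc.fac _ j
          exact h ▸ (s.ι.app j).continuous⟩
        fac := fun s j => hom_ext (hc.fac (forget.mapCocone s) j)
        uniq := fun s m hm => hom_ext <| hc.uniq (forget.mapCocone s) m.toHom fun j =>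
          congrArg Hom.toHom (hm j) }⟩⟩

/-! ### Classical convergence coframes -/

/-- The filter generated by the complemented elements of a filter. -/
def complementedFilter {L : CoFrm.{u}} (F : PFilter L) : PFilter L :=
  IsPFilter.toPFilter (F := {a | ∃ b ∈ F, IsComplemented b ∧ b ≤ a}) <| IsPFilter.of_def
    ⟨⊤, ⊤, PFilter.top_mem, isComplemented_top, le_rfl⟩
    (fun _ ⟨b, hb, hbc, hba⟩ _ ⟨b', hb', hbc', hba'⟩ =>
      ⟨b ⊓ b', ⟨b ⊓ b', PFilter.inf_mem hb hb', hbc.inf hbc', le_rfl⟩,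
        inf_le_left.trans hba, inf_le_right.trans hba'⟩)
    (fun h ⟨b, hb, hbc, hba⟩ => ⟨b, hb, hbc, hba.trans h⟩)

/-- For a classical `L`, the inequality `lim F ≤ lim G` only needs the complemented elements of `F`
to lie in `G`: replace `F` by the filter that its complemented elements generate. -/
theorem IsClassical.lim_le_lim {L : CvCoFrm.{u}} (hL : IsClassical L) {F G : PFilter L.toCoFrm}
    (h : ∀ a ∈ F, IsComplemented a → a ∈ G) : L.lim F ≤ L.lim G := by
  have hF : L.lim F = L.lim (complementedFilter F) := hL _ _ <| by
    ext a
    refine and_congr_left fun hac => ⟨fun ha => ⟨a, ha, hac, le_rfl⟩, ?_⟩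
    rintro ⟨b, hb, -, hba⟩
    exact PFilter.mem_of_le hba hb
  rw [hF]
  refine L.lim.monotone ?_
  rintro a ⟨b, hb, hbc, hba⟩
  exact PFilter.mem_of_le hba (h b hb hbc)

theorem _root_.CoframeHom.isComplemented_map {L M : Type*} [CompleteLattice L] [CompleteLattice M]
    (φ : CoframeHom L M) {a : L} (ha : IsComplemented a) : IsComplemented (φ a) := by
  obtain ⟨b, hb⟩ := ha
  refine ⟨φ b, disjoint_iff.2 ?_, codisjoint_iff.2 ?_⟩
  · rw [← map_inf, hb.inf_eq_bot, map_bot]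
  · rw [← map_sup, hb.sup_eq_top, map_top]

/-- The least classical convergence structure above that of `L`. -/
def classicalLim (L : CvCoFrm.{u}) : PFilter L.toCoFrm →o L.toCoFrm where
  toFun G := ⨆ F : {F : PFilter L.toCoFrm // ∀ a ∈ F, IsComplemented a → a ∈ G}, L.lim F
  monotone' _ _ h := iSup_le fun F =>
    le_iSup_of_le ⟨F.1, fun a ha hac => h (F.2 a ha hac)⟩ le_rfl

theorem lim_le_classicalLim (L : CvCoFrm.{u}) (F : PFilter L.toCoFrm) :
    L.lim F ≤ L.classicalLim F :=
  le_iSup_of_le (⟨F, fun _ ha _ => ha⟩ :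
    {G : PFilter L.toCoFrm // ∀ a ∈ G, IsComplemented a → a ∈ F}) le_rfl

theorem isClassical_classicalLim (L : CvCoFrm.{u}) :
    IsClassical ⟨L.toCoFrm, L.classicalLim⟩ := by
  have key (F G : PFilter L.toCoFrm)
      (h : (F : Set L.toCoFrm) ∩ {a | IsComplemented a} = ↑G ∩ {a | IsComplemented a}) :
      L.classicalLim F ≤ L.classicalLim G :=
    iSup_le fun A => le_iSup_of_le
      ⟨A.1, fun a ha hac => (h.subset ⟨A.2 a ha hac, hac⟩).1⟩ le_rfl
  exact fun F G h => le_antisymm (key F G h) (key G F h.symm)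

/-- The coreflection of a convergence coframe in the classical ones. -/
def classicalCoreflection (L : CvCoFrm.{u}) : CvclCoFrm.{u} :=
  ⟨⟨L.toCoFrm, L.classicalLim⟩, L.isClassical_classicalLim⟩

/-- The point is that `f`, being a coframe morphism, preserves complemented elements, so that
`f⁻¹ F` has its complemented elements in `f⁻¹ G` whenever `F` has them in `G`. -/
theorem isContinuous_to_classicalLim {N L : CvCoFrm.{u}} (hN : IsClassical N) (f : N ⟶ L) :
    IsContinuous N ⟨L.toCoFrm, L.classicalLim⟩ f.toHom.hom := fun _ =>
  iSup_le fun F => (f.continuous F).trans <| OrderHomClass.mono f.toHom.hom <|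
    hN.lim_le_lim fun _ ha hac => F.2 _ ha (f.toHom.hom.isComplemented_map hac)

/-- A coframe morphism from a classical convergence coframe to `L` is continuous if and only if it
is continuous to the coreflection of `L`. -/
instance : Coreflective IsClassical.{u}.ι where
  R := _
  adj := Adjunction.adjunctionOfEquivRight (F := IsClassical.ι) (G_obj := classicalCoreflection)
    (fun N L =>
      { toFun := fun f => ObjectProperty.homMk
          ⟨f.toHom, isContinuous_to_classicalLim N.property f⟩
        invFun := fun g => ⟨g.hom.toHom, fun F =>
          (L.lim_le_classicalLim F).trans (g.hom.continuous F)⟩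
        left_inv := fun _ => rfl
        right_inv := fun _ => rfl })
    (fun _ _ _ _ _ => rfl)

end CvCoFrm

theorem mainTheorem3 :
    (HasLimits CvCoFrm.{u} ∧ HasColimits CvCoFrm.{u}) ∧
      (HasLimits CvclCoFrm.{u} ∧ HasColimits CvclCoFrm.{u}) := by
  exact ⟨⟨inferInstance, inferInstance⟩,
    hasLimits_of_coreflective CvCoFrm.IsClassical.ι,
    hasColimits_of_coreflective CvCoFrm.IsClassical.ι⟩
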